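/- For every constant $\varepsilon$ with $0\le\varepsilon<\tfrac12$ there are a constant $c>0$ and an $n_0\in\mathbb N$ such that the following holds for all $n\ge n_0$. Let $\mathcal A$ be a quantum query algorithm that, for every undirected simple graph $G$ with $n$ vertices given by an oracle for its adjacency matrix, outputs with probability at least $1-\varepsilon$ a maximum independent set of $G$, i.e. an independent set of the largest possible size $\alpha(G)$. Then $\mathcal A$ makes at least $c\,n^{1.5}$ queries to the adjacency matrix. In other words, the maximum independent set problem requires $\Omega(n^{1.5})$ quantum queries to the adjacency matrix. Here a quantum query algorithm that makes $T$ queries is a computation $U_T\,O\,U_{T-1}\,O\cdots O\,U_0\,|s_0\rangle$ on a finite-dimensional space spanned by basis states $|i,j,b,w\rangle$ with $1\le i,j\le n$, $b\in\{0,1\}$ and $w$ in a finite workspace, where $s_0$ is a basis state, the $U_t$ are arbitrary unitary operators that do not depend on $G$, and $O|i,j,b,w\rangle=|i,j,b\oplus A_{i,j},w\rangle$ for the adjacency matrix $A$ of $G$; the result is a function of the outcome of a measurement of the final state in the computational basis. -/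

import Mathlib

/-- Computational basis of the state space of a quantum algorithm that queries the adjacency matrix
of a graph with vertex set `Fin n`: a basis state `(i, j, b, w)` consists of a query position
`(i, j)`, an answer bit `b` and a state `w` of a `d`-dimensional workspace. -/
abbrev QBasis (n d : ℕ) : Type := Fin n × Fin n × ZMod 2 × Fin d

/-- A quantum query algorithm (with results in `β`) in the adjacency matrix model: the computation
`U_T O U_{T-1} O ⋯ O U_0 |init⟩` with `T = queries` calls of the oracle `O` and arbitrary unitary
operators `U_t` that do not depend on the input, followed by a measurement in the computational
basis, whose outcome is turned into a result by `output`. The values of `U` beyond `queries` are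
never used. -/
structure QuantumQueryAlgorithm (n : ℕ) (β : Type) where
  queries : ℕ
  d : ℕ
  init : QBasis n d
  U : ℕ → Matrix.unitaryGroup (QBasis n d) ℂ
  output : QBasis n d → β

/-- One query to the matrix `A`: the linear map `|i, j, b, w⟩ ↦ |i, j, b ⊕ A i j, w⟩`. As
`b ↦ b ⊕ A i j` is an involution, this is how it acts on the amplitudes. -/
def adjQuery {n d : ℕ} (A : Matrix (Fin n) (Fin n) (ZMod 2)) (ψ : QBasis n d → ℂ) :
    QBasis n d → ℂ :=
  fun s => ψ (s.1, s.2.1, s.2.2.1 + A s.1 s.2.1, s.2.2.2)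

namespace QuantumQueryAlgorithm

variable {n : ℕ} {β : Type}

/-- The state after `t` queries (and the unitary operator that follows the last of them). -/
noncomputable def stateAfter (𝒜 : QuantumQueryAlgorithm n β)
    (A : Matrix (Fin n) (Fin n) (ZMod 2)) : ℕ → QBasis n 𝒜.d → ℂ
  | 0 => (𝒜.U 0 : Matrix (QBasis n 𝒜.d) (QBasis n 𝒜.d) ℂ).mulVec (Pi.single 𝒜.init 1)
  | t + 1 => (𝒜.U (t + 1) : Matrix (QBasis n 𝒜.d) (QBasis n 𝒜.d) ℂ).mulVec
      (adjQuery A (stateAfter 𝒜 A t))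

open Classical in
/-- The probability that on the input graph `G` the result of the algorithm lies in `R`. -/
noncomputable def resultProb (𝒜 : QuantumQueryAlgorithm n β) (G : SimpleGraph (Fin n))
    (R : Set β) : ℝ :=
  ∑ s : QBasis n 𝒜.d with 𝒜.output s ∈ R,
    ‖𝒜.stateAfter (G.adjMatrix (ZMod 2)) 𝒜.queries s‖ ^ 2

/-- The algorithm computes a maximum independent set with error probability at most `ε`: on every
graph `G` with vertex set `Fin n` it outputs, with probability at least `1 - ε`, a maximum
independent set of `G` (any one of them, not necessarily the same in every run). -/
def ComputesMaximumIndepSet (𝒜 : QuantumQueryAlgorithm n (Finset (Fin n))) (ε : ℝ) : Prop :=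
  ∀ G : SimpleGraph (Fin n), 1 - ε ≤ 𝒜.resultProb G {S | G.IsMaximumIndepSet S}

end QuantumQueryAlgorithm

/-! This is an adversary argument on two matchings that differ in one edge `{u, v}`: `G` has `r =
⌊n/4⌋` edges and `H` one more. An independent set of `H` is smaller than a maximum one of `G`, so
the algorithm must separate the two.

Relabel both graphs by a uniformly random permutation and follow the mean squared distance of the
two states. It starts at 0 and must reach `(1 - 2ε)² / 4`. A query increases it only through the
weight that the states put on the relabelled pair `{u, v}` (`sum_norm_sq_adjQuery_sub_le`). By
symmetry this mean weight is at most `1 / r²` for `G`, where automorphisms move the non-edge to `r²`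
pairs of isolated vertices, and at most `1 / (r + 1)` for `H`, where they move the edge to any edge
(`card_mul_sum_weight_le`). With `l = √r` the gain per query is at most `4 / r^(3/2)`. -/

open Finset

/-! ### Effect of one query on the distance of two states -/

section Query

variable {n d : ℕ}

/-- Flipping the answer bit according to the matrix `A`, as a permutation of the basis states. -/
def queryPerm (A : Matrix (Fin n) (Fin n) (ZMod 2)) : Equiv.Perm (QBasis n d) :=
  Function.Involutive.toPerm (fun s => (s.1, s.2.1, s.2.2.1 + A s.1 s.2.1, s.2.2.2)) fun s => by
    simp [add_assoc, CharTwo.add_self_eq_zero]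

theorem sum_mul_queryPerm (A : Matrix (Fin n) (Fin n) (ZMod 2)) (f : Fin n → Fin n → ℝ)
    (g : QBasis n d → ℝ) :
    ∑ s : QBasis n d, f s.1 s.2.1 * g (queryPerm A s) = ∑ s : QBasis n d, f s.1 s.2.1 * g s :=
  Fintype.sum_equiv (queryPerm A) _ _ fun _ => rfl

theorem sum_norm_sq_mulVec {ι : Type*} [Fintype ι] [DecidableEq ι]
    (U : Matrix.unitaryGroup ι ℂ) (ψ : ι → ℂ) :
    ∑ s, ‖(U : Matrix ι ι ℂ).mulVec ψ s‖ ^ 2 = ∑ s, ‖ψ s‖ ^ 2 := by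
  have key : ∀ φ : ι → ℂ, ((∑ s, ‖φ s‖ ^ 2 : ℝ) : ℂ) = star φ ⬝ᵥ φ := fun φ => by
    simp [dotProduct, Complex.conj_mul']
  have hU : (U : Matrix ι ι ℂ).conjTranspose * (U : Matrix ι ι ℂ) = 1 :=
    Matrix.mem_unitaryGroup_iff'.1 U.2
  have h : star ((U : Matrix ι ι ℂ).mulVec ψ) ⬝ᵥ (U : Matrix ι ι ℂ).mulVec ψ = star ψ ⬝ᵥ ψ := by
    rw [Matrix.star_mulVec, Matrix.dotProduct_mulVec, Matrix.vecMul_vecMul, hU, Matrix.vecMul_one]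
  exact_mod_cast (key _).trans (h.trans (key _).symm)

/-- After expanding the squares only the inner products of `a` with `b` and `c` remain; AM-GM bounds
them with a free weight `l`, later used to balance two unequal query weights. -/
theorem norm_sub_sq_add_le (a b c : ℂ) {l : ℝ} (hl : 0 < l) :
    ‖a - b‖ ^ 2 + ‖c‖ ^ 2 ≤
      ‖a - c‖ ^ 2 + ‖b‖ ^ 2 + (2 * l * ‖a‖ ^ 2 + (‖b‖ ^ 2 + ‖c‖ ^ 2) / l) := by
  have h : ∀ x : ℂ, 2 * (‖a‖ * ‖x‖) ≤ l * ‖a‖ ^ 2 + ‖x‖ ^ 2 / l := fun x => by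
    have h1 : l * ‖a‖ ^ 2 + ‖x‖ ^ 2 / l - 2 * (‖a‖ * ‖x‖) = (l * ‖a‖ - ‖x‖) ^ 2 / l := by
      field_simp
      ring
    have h2 : 0 ≤ (l * ‖a‖ - ‖x‖) ^ 2 / l := by positivity
    linarith
  have hb := h b
  have hc := h c
  have hb' := abs_le.1 (abs_real_inner_le_norm a b)
  have hc' := abs_le.1 (abs_real_inner_le_norm a c)
  rw [norm_sub_sq_real, norm_sub_sq_real, add_div]
  linarith [hb'.1, hc'.2]

/-- One query to matrices that differ only on positions satisfying `P` changes the squared distance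
of two states by an amount controlled by their weights on these positions. -/
theorem sum_norm_sq_adjQuery_sub_le (A B : Matrix (Fin n) (Fin n) (ZMod 2))
    (P : Fin n → Fin n → Prop) [∀ i j, Decidable (P i j)]
    (hAB : ∀ i j, ¬ P i j → A i j = B i j) (ψ φ : QBasis n d → ℂ) {l : ℝ} (hl : 0 < l) :
    ∑ s, ‖adjQuery A ψ s - adjQuery B φ s‖ ^ 2 ≤ ∑ s, ‖ψ s - φ s‖ ^ 2 +
      (2 * l * ∑ s : QBasis n d, (if P s.1 s.2.1 then 1 else 0) * ‖ψ s‖ ^ 2 +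
        2 / l * ∑ s : QBasis n d, (if P s.1 s.2.1 then 1 else 0) * ‖φ s‖ ^ 2) := by
  have key : ∀ s : QBasis n d,
      ‖adjQuery A ψ s - adjQuery B φ s‖ ^ 2 + ‖φ (queryPerm A s)‖ ^ 2 ≤
      ‖(fun s => ψ s - φ s) (queryPerm A s)‖ ^ 2 + ‖φ (queryPerm B s)‖ ^ 2 +
      (2 * l * ((if P s.1 s.2.1 then 1 else 0) * ‖ψ (queryPerm A s)‖ ^ 2) +
        ((if P s.1 s.2.1 then 1 else 0) * ‖φ (queryPerm B s)‖ ^ 2 / l +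
        (if P s.1 s.2.1 then 1 else 0) * ‖φ (queryPerm A s)‖ ^ 2 / l)) := fun s => by
    change ‖ψ (queryPerm A s) - φ (queryPerm B s)‖ ^ 2 + _ ≤ _
    split_ifs with h
    · have := norm_sub_sq_add_le (ψ (queryPerm A s)) (φ (queryPerm B s)) (φ (queryPerm A s)) hl
      simp only [one_mul]
      rw [add_div] at this
      linarith
    · have : queryPerm A s = queryPerm B s := by
        change (s.1, s.2.1, s.2.2.1 + A s.1 s.2.1, s.2.2.2) = (_, _, s.2.2.1 + B s.1 s.2.1, _)
        rw [hAB _ _ h]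
      simp [this]
  -- A query permutes basis states and fixes the position `(i, j)`, so after summation the norms of
  -- `φ` on both sides cancel and the weights on `P` lose their permutations.
  have hsum := Finset.sum_le_sum fun s (_ : s ∈ univ) => key s
  simp only [Finset.sum_add_distrib, ← Finset.mul_sum, ← Finset.sum_div] at hsum
  have e1 : ∀ (C : Matrix (Fin n) (Fin n) (ZMod 2)) (χ : QBasis n d → ℂ),
      ∑ s, ‖χ (queryPerm C s)‖ ^ 2 = ∑ s, ‖χ s‖ ^ 2 := fun C χ =>
    Equiv.sum_comp (queryPerm C) fun s => ‖χ s‖ ^ 2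
  have e2 : ∀ (C : Matrix (Fin n) (Fin n) (ZMod 2)) (χ : QBasis n d → ℂ),
      ∑ s : QBasis n d, (if P s.1 s.2.1 then (1 : ℝ) else 0) * ‖χ (queryPerm C s)‖ ^ 2 =
      ∑ s : QBasis n d, (if P s.1 s.2.1 then (1 : ℝ) else 0) * ‖χ s‖ ^ 2 := fun C χ =>
    sum_mul_queryPerm C (fun i j => if P i j then 1 else 0) fun s => ‖χ s‖ ^ 2
  have e0 := e1 A fun s => ψ s - φ s
  rw [e1, e1, e0, e2, e2, e2] at hsum
  have e3 : ∀ x : ℝ, 2 / l * x = x / l + x / l := fun x => by ring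
  rw [e3]
  linarith

end Query

/-! ### The adversary bound -/

namespace QuantumQueryAlgorithm

variable {n : ℕ} {β : Type}

theorem sum_norm_sq_stateAfter (𝒜 : QuantumQueryAlgorithm n β)
    (A : Matrix (Fin n) (Fin n) (ZMod 2)) (t : ℕ) : ∑ s, ‖𝒜.stateAfter A t s‖ ^ 2 = 1 := by
  induction t with
  | zero =>
    rw [stateAfter, sum_norm_sq_mulVec, Finset.sum_eq_single 𝒜.init] <;> simp +contextual
  | succ t ih =>
    rw [stateAfter, sum_norm_sq_mulVec, ← ih]
    exact Equiv.sum_comp (queryPerm A) fun s => ‖𝒜.stateAfter A t s‖ ^ 2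

open Classical in
/-- The state after `t` queries on the input graph `G`. -/
noncomputable def graphState (𝒜 : QuantumQueryAlgorithm n β) (t : ℕ) (G : SimpleGraph (Fin n)) :
    QBasis n 𝒜.d → ℂ :=
  𝒜.stateAfter (G.adjMatrix (ZMod 2)) t

theorem sum_norm_sq_graphState (𝒜 : QuantumQueryAlgorithm n β) (t : ℕ)
    (G : SimpleGraph (Fin n)) : ∑ s, ‖𝒜.graphState t G s‖ ^ 2 = 1 :=
  𝒜.sum_norm_sq_stateAfter _ t

theorem sum_norm_sq_graphState_zero_sub (𝒜 : QuantumQueryAlgorithm n β)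
    (G H : SimpleGraph (Fin n)) :
    ∑ s, ‖𝒜.graphState 0 G s - 𝒜.graphState 0 H s‖ ^ 2 = 0 := by
  simp [graphState, stateAfter]

theorem sum_norm_sq_graphState_succ_sub_le (𝒜 : QuantumQueryAlgorithm n β) (t : ℕ)
    (G H : SimpleGraph (Fin n)) (P : Fin n → Fin n → Prop) [∀ i j, Decidable (P i j)]
    (hGH : ∀ i j, ¬ P i j → (G.Adj i j ↔ H.Adj i j)) {l : ℝ} (hl : 0 < l) :
    ∑ s, ‖𝒜.graphState (t + 1) G s - 𝒜.graphState (t + 1) H s‖ ^ 2 ≤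
      ∑ s, ‖𝒜.graphState t G s - 𝒜.graphState t H s‖ ^ 2 +
      (2 * l * ∑ s : QBasis n 𝒜.d, (if P s.1 s.2.1 then 1 else 0) * ‖𝒜.graphState t G s‖ ^ 2 +
        2 / l *
          ∑ s : QBasis n 𝒜.d, (if P s.1 s.2.1 then 1 else 0) * ‖𝒜.graphState t H s‖ ^ 2) := by
  classical
  refine le_trans (le_of_eq ?_) (sum_norm_sq_adjQuery_sub_le (G.adjMatrix (ZMod 2))
    (H.adjMatrix (ZMod 2)) P (fun i j h => ?_) _ _ hl)
  · refine Eq.trans ?_ (sum_norm_sq_mulVec (𝒜.U (t + 1)) _)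
    refine Finset.sum_congr rfl fun s _ => ?_
    rw [← Pi.sub_def, Matrix.mulVec_sub, Pi.sub_apply]
    simp only [graphState, stateAfter]
  · simp only [SimpleGraph.adjMatrix_apply, hGH i j h]

/-- States that are told apart by a measurement with error probability at most `ε` have squared
distance at least `(1 - 2ε)² / 4`. -/
theorem le_sum_norm_sq_sub {ι : Type*} [Fintype ι] (R S : Finset ι) (hRS : Disjoint R S)
    {ψ φ : ι → ℂ} (hψ : ∑ s, ‖ψ s‖ ^ 2 = 1) (hφ : ∑ s, ‖φ s‖ ^ 2 = 1) {ε : ℝ} (hε : ε < 1 / 2)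
    (hR : 1 - ε ≤ ∑ s ∈ R, ‖ψ s‖ ^ 2) (hS : 1 - ε ≤ ∑ s ∈ S, ‖φ s‖ ^ 2) :
    (1 - 2 * ε) ^ 2 / 4 ≤ ∑ s, ‖ψ s - φ s‖ ^ 2 := by
  classical
  have hRφ : ∑ s ∈ R, ‖φ s‖ ^ 2 ≤ ε := by
    have := Finset.sum_le_univ_sum_of_nonneg (s := R ∪ S) fun s => sq_nonneg ‖φ s‖
    rw [Finset.sum_union hRS] at this
    linarith
  -- On `R` the probabilities differ by at least `2η`; the AM-GM error term sums to at most `η`,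
  -- leaving `η` for the distance.
  set η : ℝ := (1 - 2 * ε) / 2 with hη
  have hη0 : 0 < η := by linarith
  have key : ∀ s, ‖ψ s‖ ^ 2 ≤
      ‖φ s‖ ^ 2 + (‖ψ s - φ s‖ ^ 2 / η + η / 2 * (‖ψ s‖ ^ 2 + ‖φ s‖ ^ 2)) := fun s => by
    have h1 : ‖ψ s‖ ≤ ‖ψ s - φ s‖ + ‖φ s‖ := norm_le_norm_sub_add _ _
    have h2 : ‖ψ s - φ s‖ ^ 2 / η + η / 4 * (‖ψ s‖ + ‖φ s‖) ^ 2 -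
        ‖ψ s - φ s‖ * (‖ψ s‖ + ‖φ s‖) =
        (‖ψ s - φ s‖ - η / 2 * (‖ψ s‖ + ‖φ s‖)) ^ 2 / η := by
      field_simp
      ring
    have h3 : 0 ≤ (‖ψ s - φ s‖ - η / 2 * (‖ψ s‖ + ‖φ s‖)) ^ 2 / η := by positivity
    have h4 : (‖ψ s‖ - ‖φ s‖) * (‖ψ s‖ + ‖φ s‖) ≤ ‖ψ s - φ s‖ * (‖ψ s‖ + ‖φ s‖) := by
      gcongr
      linarith
    have h5 : 0 ≤ η / 4 * (‖ψ s‖ - ‖φ s‖) ^ 2 := by positivity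
    linarith
  have hsum := Finset.sum_le_sum fun s (_ : s ∈ R) => key s
  rw [Finset.sum_add_distrib] at hsum
  have h6 : ∑ s ∈ R, (‖ψ s - φ s‖ ^ 2 / η + η / 2 * (‖ψ s‖ ^ 2 + ‖φ s‖ ^ 2)) ≤
      ∑ s, (‖ψ s - φ s‖ ^ 2 / η + η / 2 * (‖ψ s‖ ^ 2 + ‖φ s‖ ^ 2)) :=
    Finset.sum_le_univ_sum_of_nonneg fun s => by positivity
  rw [Finset.sum_add_distrib (s := univ), ← Finset.sum_div univ, ← Finset.mul_sum univ,
    Finset.sum_add_distrib (s := univ), hψ, hφ] at h6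
  have h7 : η ≤ (∑ s, ‖ψ s - φ s‖ ^ 2) / η := by linarith
  rw [le_div_iff₀ hη0] at h7
  calc (1 - 2 * ε) ^ 2 / 4 = η * η := by rw [hη]; ring
    _ ≤ _ := h7

theorem ComputesMaximumIndepSet.le_sum_norm_sq_sub
    {𝒜 : QuantumQueryAlgorithm n (Finset (Fin n))} {ε : ℝ} (h𝒜 : 𝒜.ComputesMaximumIndepSet ε)
    (hε : ε < 1 / 2) {G H : SimpleGraph (Fin n)}
    (hGH : ∀ S, G.IsMaximumIndepSet S → ¬ H.IsMaximumIndepSet S) :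
    (1 - 2 * ε) ^ 2 / 4 ≤
      ∑ s, ‖𝒜.graphState 𝒜.queries G s - 𝒜.graphState 𝒜.queries H s‖ ^ 2 := by
  classical
  refine QuantumQueryAlgorithm.le_sum_norm_sq_sub
    (univ.filter fun s => G.IsMaximumIndepSet (𝒜.output s))
    (univ.filter fun s => H.IsMaximumIndepSet (𝒜.output s))
    (Finset.disjoint_filter.2 fun s _ => hGH _) (𝒜.sum_norm_sq_graphState _ _)
    (𝒜.sum_norm_sq_graphState _ _) hε ((h𝒜 G).trans (le_of_eq ?_)) ((h𝒜 H).trans (le_of_eq ?_))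
  all_goals
    simp only [resultProb, graphState, Set.mem_ofPred_eq]

/-- If a permutation `σ` of a graph is chosen uniformly at random, then the weight of the state on
the queries to the edge `{u, v}` is at most `1 / N`, where `N` is the number of edges to which
automorphisms of the graph map `{u, v}`. -/
theorem card_mul_sum_weight_le {ι : Type*} [Fintype ι] {d : ℕ} (G : SimpleGraph (Fin n))
    (u v : Fin n) (τ : ι → Equiv.Perm (Fin n)) (hτ : ∀ i, G.comap (τ i) = G)
    (hinj : Function.Injective fun i => s((τ i).symm u, (τ i).symm v))
    (f : SimpleGraph (Fin n) → QBasis n d → ℂ) (hf : ∀ H, ∑ s, ‖f H s‖ ^ 2 = 1) :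
    Fintype.card ι * ∑ σ : Equiv.Perm (Fin n), ∑ s : QBasis n d,
      (if s(σ s.1, σ s.2.1) = s(u, v) then (1 : ℝ) else 0) * ‖f (G.comap σ) s‖ ^ 2 ≤
      (Fintype.card (Equiv.Perm (Fin n)) : ℝ) := by
  have hG : ∀ i (σ : Equiv.Perm (Fin n)), G.comap (τ i * σ : Equiv.Perm (Fin n)) = G.comap σ := by
    intro i σ
    conv_rhs => rw [← hτ i, SimpleGraph.comap_comap]
    rfl
  have he : ∀ i (σ : Equiv.Perm (Fin n)) (a b : Fin n),
      s((τ i * σ) a, (τ i * σ) b) = s(u, v) ↔ s((τ i).symm u, (τ i).symm v) = s(σ a, σ b) := by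
    intro i σ a b
    rw [eq_comm]
    simp only [Sym2.eq_iff, Equiv.Perm.mul_apply, Equiv.symm_apply_eq]
  calc _ = ∑ _i : ι, ∑ σ : Equiv.Perm (Fin n), ∑ s : QBasis n d,
      (if s(σ s.1, σ s.2.1) = s(u, v) then (1 : ℝ) else 0) * ‖f (G.comap σ) s‖ ^ 2 := by simp
    _ = ∑ i : ι, ∑ σ : Equiv.Perm (Fin n), ∑ s : QBasis n d,
      (if s((τ i).symm u, (τ i).symm v) = s(σ s.1, σ s.2.1) then (1 : ℝ) else 0) *
        ‖f (G.comap σ) s‖ ^ 2 := by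
        refine Finset.sum_congr rfl fun i _ => ?_
        -- Replacing `σ` by `τ i * σ` keeps the relabelled graph and moves the tracked pair to its
        -- `i`-th image.
        rw [← Equiv.sum_comp (Equiv.mulLeft (τ i))]
        simp only [Equiv.coe_mulLeft, hG, he]
    _ = ∑ σ : Equiv.Perm (Fin n), ∑ s : QBasis n d,
      (∑ i : ι, if s((τ i).symm u, (τ i).symm v) = s(σ s.1, σ s.2.1) then (1 : ℝ) else 0) *
        ‖f (G.comap σ) s‖ ^ 2 := by
        rw [Finset.sum_comm]
        refine Finset.sum_congr rfl fun σ _ => ?_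
        rw [Finset.sum_comm]
        simp only [Finset.sum_mul]
    _ ≤ ∑ σ : Equiv.Perm (Fin n), ∑ s : QBasis n d, 1 * ‖f (G.comap σ) s‖ ^ 2 := by
        refine Finset.sum_le_sum fun σ _ => Finset.sum_le_sum fun s _ => ?_
        gcongr
        -- The images are distinct, so a query position hits at most one.
        rw [Finset.sum_boole, Nat.cast_le_one, Finset.card_le_one]
        intro i hi j hj
        simp only [Finset.mem_filter, Finset.mem_univ, true_and] at hi hj
        exact hinj (hi.trans hj.symm)
    _ = (Fintype.card (Equiv.Perm (Fin n)) : ℝ) := by simp [hf]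

/-- The adversary bound for graphs `G`, `H` that differ in the edge `{u, v}` only. -/
theorem ComputesMaximumIndepSet.le_queries_mul {ι κ : Type*} [Fintype ι] [Fintype κ] [Nonempty ι]
    [Nonempty κ] {𝒜 : QuantumQueryAlgorithm n (Finset (Fin n))} {ε : ℝ}
    (h𝒜 : 𝒜.ComputesMaximumIndepSet ε) (hε : ε < 1 / 2) {G H : SimpleGraph (Fin n)} {u v : Fin n}
    (hGH : ∀ i j, s(i, j) ≠ s(u, v) → (G.Adj i j ↔ H.Adj i j))
    (hmax : ∀ (σ : Equiv.Perm (Fin n)) (S : Finset (Fin n)),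
      (G.comap σ).IsMaximumIndepSet S → ¬ (H.comap σ).IsMaximumIndepSet S)
    (τ : ι → Equiv.Perm (Fin n)) (hτ : ∀ i, G.comap (τ i) = G)
    (hτinj : Function.Injective fun i => s((τ i).symm u, (τ i).symm v))
    (ρ : κ → Equiv.Perm (Fin n)) (hρ : ∀ i, H.comap (ρ i) = H)
    (hρinj : Function.Injective fun i => s((ρ i).symm u, (ρ i).symm v)) {l : ℝ} (hl : 0 < l) :
    (1 - 2 * ε) ^ 2 / 4 ≤
      𝒜.queries * (2 * l / Fintype.card ι + 2 / l / Fintype.card κ) := by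
  set N : ℝ := ((Fintype.card (Equiv.Perm (Fin n)) : ℕ) : ℝ) with hN
  have hN0 : 0 < N := by simp [hN, Fintype.card_pos]
  have hι : (0 : ℝ) < Fintype.card ι := by exact_mod_cast Fintype.card_pos
  have hκ : (0 : ℝ) < Fintype.card κ := by exact_mod_cast Fintype.card_pos
  have step : ∀ t : ℕ, ∑ σ : Equiv.Perm (Fin n),
      ∑ s, ‖𝒜.graphState t (G.comap σ) s - 𝒜.graphState t (H.comap σ) s‖ ^ 2 ≤
      t * (2 * l / Fintype.card ι + 2 / l / Fintype.card κ) * N := by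
    intro t
    induction t with
    | zero => simp [sum_norm_sq_graphState_zero_sub]
    | succ t ih =>
      have h1 := Finset.sum_le_sum fun (σ : Equiv.Perm (Fin n)) (_ : σ ∈ univ) =>
        𝒜.sum_norm_sq_graphState_succ_sub_le t (G.comap σ) (H.comap σ)
          (fun i j => s(σ i, σ j) = s(u, v)) (fun i j h => hGH _ _ h) hl
      simp only [Finset.sum_add_distrib, ← Finset.mul_sum] at h1
      have h2 := card_mul_sum_weight_le G u v τ hτ hτinj _ (𝒜.sum_norm_sq_graphState t)
      have h3 := card_mul_sum_weight_le H u v ρ hρ hρinj _ (𝒜.sum_norm_sq_graphState t)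
      rw [← le_div_iff₀' hι] at h2
      rw [← le_div_iff₀' hκ] at h3
      have h4 := mul_le_mul_of_nonneg_left h2 (show 0 ≤ 2 * l by positivity)
      have h5 := mul_le_mul_of_nonneg_left h3 (show 0 ≤ 2 / l by positivity)
      push_cast
      calc _ ≤ _ := h1
        _ ≤ t * (2 * l / Fintype.card ι + 2 / l / Fintype.card κ) * N +
          (2 * l * (N / Fintype.card ι) + 2 / l * (N / Fintype.card κ)) :=
            add_le_add ih (add_le_add h4 h5)
        _ = _ := by ring
  have hlow : N * ((1 - 2 * ε) ^ 2 / 4) ≤ ∑ σ : Equiv.Perm (Fin n), ∑ s,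
      ‖𝒜.graphState 𝒜.queries (G.comap σ) s - 𝒜.graphState 𝒜.queries (H.comap σ) s‖ ^ 2 := by
    rw [hN, ← Finset.card_univ, ← nsmul_eq_mul]
    exact Finset.card_nsmul_le_sum _ _ _ fun σ _ => h𝒜.le_sum_norm_sq_sub hε (hmax σ)
  have := hlow.trans (step 𝒜.queries)
  rw [mul_comm] at this
  exact le_of_mul_le_mul_right this hN0

end QuantumQueryAlgorithm

/-! ### Matchings, their independent sets and automorphisms -/

section Matching

/-- The matching with the edges `{a, m + a}` for `a < k`. -/
def shiftMatching (n m k : ℕ) : SimpleGraph (Fin n) where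
  Adj i j := (i.1 < k ∧ j.1 = m + i.1 ∧ 0 < m) ∨ (j.1 < k ∧ i.1 = m + j.1 ∧ 0 < m)
  symm := ⟨fun _ _ h => h.symm⟩
  loopless := ⟨fun i h => by omega⟩

variable {n : ℕ}

theorem shiftMatching_adj {m k : ℕ} {i j : Fin n} : (shiftMatching n m k).Adj i j ↔
    (i.1 < k ∧ j.1 = m + i.1 ∧ 0 < m) ∨ (j.1 < k ∧ i.1 = m + j.1 ∧ 0 < m) := Iff.rfl

/-- The `k + 1` edges are pairwise disjoint and each has an endpoint outside `S`. -/
theorem card_lt_of_isIndepSet_shiftMatching {m k : ℕ} (hkm : k < m) (hmn : 2 * m ≤ n)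
    {S : Finset (Fin n)} (hS : (shiftMatching n m (k + 1)).IsIndepSet S) : S.card < n - k := by
  classical
  have h : ∀ a : Fin (k + 1), ∃ x : Fin n, x ∉ S ∧ (x.1 = a ∨ x.1 = m + a) := by
    intro a
    by_contra! hc
    have h1 : (⟨a, by omega⟩ : Fin n) ∈ S := by
      by_contra h
      exact (hc _ h).1 rfl
    have h2 : (⟨m + a, by omega⟩ : Fin n) ∈ S := by
      by_contra h
      exact (hc _ h).2 rfl
    refine hS h1 h2 (by simp [Fin.ext_iff]; omega) (Or.inl ⟨a.2, rfl, by omega⟩)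
  choose f hf hfa using h
  have hinj : Function.Injective f := fun a b hab => by
    have h1 := hfa a
    have h2 := hfa b
    rw [hab] at h1
    ext
    omega
  have := Finset.card_le_card_of_injOn (s := univ) (t := Sᶜ) f (fun a _ => by simp [hf])
    hinj.injOn
  rw [Finset.card_compl] at this
  simp only [Finset.card_univ, Fintype.card_fin] at this
  omega

theorem exists_isIndepSet_shiftMatching {m k : ℕ} (hkn : k ≤ n) :
    ∃ S : Finset (Fin n), (shiftMatching n m k).IsIndepSet S ∧ S.card = n - k := by
  classical
  refine ⟨(univ.filter fun i : Fin n => i.1 < k)ᶜ, ?_, ?_⟩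
  · intro i hi j hj _ hij
    simp only [Finset.coe_compl, Set.mem_compl_iff, Finset.mem_coe, Finset.mem_filter,
      Finset.mem_univ, true_and] at hi hj
    rw [shiftMatching_adj] at hij
    omega
  · rw [Finset.card_compl, Fin.card_filter_val_lt, Fintype.card_fin]
    omega

theorem not_isMaximumIndepSet_shiftMatching_succ {m k : ℕ} (hkm : k < m) (hmn : 2 * m ≤ n)
    (σ : Equiv.Perm (Fin n)) (S : Finset (Fin n))
    (hS : ((shiftMatching n m k).comap σ).IsMaximumIndepSet S) :
    ¬ ((shiftMatching n m (k + 1)).comap σ).IsMaximumIndepSet S := by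
  intro hS'
  obtain ⟨K, hK, hKc⟩ := exists_isIndepSet_shiftMatching (n := n) (m := m) (k := k) (by omega)
  have h1 : (S.map σ.toEmbedding).card < n - k := by
    refine card_lt_of_isIndepSet_shiftMatching hkm hmn ?_
    intro x hx y hy hxy hadj
    simp only [Finset.coe_map, Equiv.coe_toEmbedding, Set.mem_image, Finset.mem_coe] at hx hy
    obtain ⟨x, hx, rfl⟩ := hx
    obtain ⟨y, hy, rfl⟩ := hy
    exact hS'.isIndepSet hx hy (fun h => hxy (by rw [h])) hadj
  have h2 : (K.map σ.symm.toEmbedding).card ≤ S.card := by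
    refine hS.maximum _ ?_
    intro x hx y hy hxy hadj
    simp only [Finset.coe_map, Equiv.coe_toEmbedding, Set.mem_image, Finset.mem_coe] at hx hy
    obtain ⟨x, hx, rfl⟩ := hx
    obtain ⟨y, hy, rfl⟩ := hy
    refine hK hx hy (fun h => hxy (by rw [h])) ?_
    simpa using hadj
  rw [Finset.card_map] at h1 h2
  omega

theorem comap_eq_of_forall_adj {V : Type*} {G : SimpleGraph V} (τ : Equiv.Perm V)
    (hinv : ∀ x, τ (τ x) = x) (h : ∀ i j, G.Adj i j → G.Adj (τ i) (τ j)) : G.comap τ = G := by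
  ext i j
  refine ⟨fun hij => ?_, h i j⟩
  have h1 := h _ _ hij
  rwa [hinv, hinv] at h1

/-- The permutation of `Fin n` that swaps `a` with `b` and `c` with `d`, where `a`, `b` are smaller
than `m` and `c`, `d` are not. -/
def doubleSwap (m : ℕ) (a b c d : Fin n) (h : a.1 < m ∧ b.1 < m ∧ m ≤ c.1 ∧ m ≤ d.1) :
    Equiv.Perm (Fin n) :=
  Function.Involutive.toPerm
    (fun x => if x = a then b else if x = b then a else if x = c then d else if x = d then c else x)
    fun x => by grind

theorem doubleSwap_apply {m : ℕ} {a b c d : Fin n}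
    (h : a.1 < m ∧ b.1 < m ∧ m ≤ c.1 ∧ m ≤ d.1) (x : Fin n) : doubleSwap m a b c d h x =
      if x = a then b else if x = b then a else if x = c then d else if x = d then c else x := rfl

theorem doubleSwap_symm {m : ℕ} {a b c d : Fin n}
    (h : a.1 < m ∧ b.1 < m ∧ m ≤ c.1 ∧ m ≤ d.1) :
    (doubleSwap m a b c d h).symm = doubleSwap m a b c d h := rfl

/-- The alternatives in `hk`: all four vertices are isolated, or the edges `{a, c}` and `{b, d}` are
exchanged. -/
theorem comap_doubleSwap_shiftMatching {m k : ℕ} {a b c d : Fin n}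
    (h : a.1 < m ∧ b.1 < m ∧ m ≤ c.1 ∧ m ≤ d.1)
    (hk : (k ≤ a.1 ∧ k ≤ b.1 ∧ m + k ≤ c.1 ∧ m + k ≤ d.1) ∨
      (a.1 < k ∧ b.1 < k ∧ c.1 = m + a.1 ∧ d.1 = m + b.1)) (hkm : k ≤ m) :
    (shiftMatching n m k).comap (doubleSwap m a b c d h) = shiftMatching n m k := by
  refine comap_eq_of_forall_adj _ (fun x => (doubleSwap m a b c d h).symm_apply_apply x) ?_
  intro i j hij
  rw [shiftMatching_adj] at hij ⊢
  simp only [doubleSwap_apply, Fin.ext_iff, apply_ite Fin.val]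
  split_ifs <;> omega

end Matching

/-! ### Choice of parameters and conclusion -/

theorem QuantumQueryAlgorithm.ComputesMaximumIndepSet.le_queries {n r : ℕ} (hr : 0 < r)
    (hrn : 4 * r ≤ n) {𝒜 : QuantumQueryAlgorithm n (Finset (Fin n))} {ε : ℝ}
    (h𝒜 : 𝒜.ComputesMaximumIndepSet ε) (hε : ε < 1 / 2) :
    (1 - 2 * ε) ^ 2 / 16 * (r : ℝ) ^ (3 / 2 : ℝ) ≤ 𝒜.queries := by
  have hr0 : (0 : ℝ) < r := by exact_mod_cast hr
  have : Nonempty (Fin r × Fin r) := ⟨⟨⟨0, hr⟩, ⟨0, hr⟩⟩⟩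
  have hτ : ∀ p : Fin r × Fin r, (r < 2 * r ∧ r + p.1.1 < 2 * r ∧ 2 * r ≤ 3 * r ∧
      2 * r ≤ 3 * r + p.2.1) := fun p => by omega
  have hρ : ∀ a : Fin (r + 1), (r < 2 * r ∧ a.1 < 2 * r ∧ 2 * r ≤ 3 * r ∧
      2 * r ≤ 2 * r + a.1) := fun a => by omega
  have key := h𝒜.le_queries_mul hε (G := shiftMatching n (2 * r) r)
    (H := shiftMatching n (2 * r) (r + 1)) (u := ⟨r, by omega⟩) (v := ⟨3 * r, by omega⟩)
    (fun i j hij => ?_)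
    (not_isMaximumIndepSet_shiftMatching_succ (by omega) (by omega))
    (fun p : Fin r × Fin r => doubleSwap (2 * r) ⟨r, by omega⟩ ⟨r + p.1.1, by omega⟩
      ⟨3 * r, by omega⟩ ⟨3 * r + p.2.1, by omega⟩ (hτ p))
    (fun p => comap_doubleSwap_shiftMatching _ (Or.inl (by simp only; omega)) (by omega))
    (fun p q hpq => ?_)
    (fun a : Fin (r + 1) => doubleSwap (2 * r) ⟨r, by omega⟩ ⟨a.1, by omega⟩
      ⟨3 * r, by omega⟩ ⟨2 * r + a.1, by omega⟩ (hρ a))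
    (fun p => comap_doubleSwap_shiftMatching _ (Or.inr ⟨r.lt_succ_self, p.2, by simp only; omega, rfl⟩) (by omega))
    -- `l = √r` balances `2l / r²` against `2 / (l (r + 1))`.
    (fun a b hab => ?_) (Real.sqrt_pos.2 hr0)
  · set q := √(r : ℝ) with hq
    have hq0 : 0 < q := Real.sqrt_pos.2 hr0
    have hqr : (r : ℝ) = q ^ 2 := (Real.sq_sqrt hr0.le).symm
    have hpow : (r : ℝ) ^ (3 / 2 : ℝ) = q ^ 3 := by
      rw [hq, Real.sqrt_eq_rpow, ← Real.rpow_natCast, ← Real.rpow_mul hr0.le]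
      norm_num
    have hle : 2 * q / (Fintype.card (Fin r × Fin r) : ℕ) + 2 / q / (Fintype.card (Fin (r + 1)) : ℕ)
        ≤ 4 / q ^ 3 := by
      simp only [Fintype.card_prod, Fintype.card_fin]
      push_cast
      rw [hqr]
      calc 2 * q / (q ^ 2 * q ^ 2) + 2 / q / (q ^ 2 + 1)
          ≤ 2 * q / (q ^ 2 * q ^ 2) + 2 / q / q ^ 2 := by
            gcongr
            linarith
        _ = 4 / q ^ 3 := by
            field_simp
            ring
    have := key.trans (mul_le_mul_of_nonneg_left hle (Nat.cast_nonneg _))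
    rw [← mul_div_assoc, le_div_iff₀ (by positivity)] at this
    rw [hpow]
    linarith
  · simp only [ne_eq, Sym2.eq_iff, Fin.ext_iff] at hij
    simp only [shiftMatching_adj]
    omega
  · simp only [doubleSwap_symm, doubleSwap_apply, Sym2.eq_iff] at hpq
    simp [Fin.ext_iff, Prod.ext_iff, apply_ite Fin.val] at hpq ⊢
    split_ifs at hpq <;> omega
  · simp only [doubleSwap_symm, doubleSwap_apply, Sym2.eq_iff] at hab
    simp [Fin.ext_iff, apply_ite Fin.val] at hab ⊢
    split_ifs at hab <;> omega

theorem mainTheorem9 (ε : ℝ) (hε₀ : 0 ≤ ε) (hε : ε < 1 / 2) :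
    ∃ c : ℝ, 0 < c ∧ ∃ n₀ : ℕ, ∀ n : ℕ, n₀ ≤ n →
      ∀ 𝒜 : QuantumQueryAlgorithm n (Finset (Fin n)),
        𝒜.ComputesMaximumIndepSet ε → c * (n : ℝ) ^ (3 / 2 : ℝ) ≤ (𝒜.queries : ℝ) := by
  have hε' : 0 < 1 - 2 * ε := by linarith
  -- For `n ≥ 4` the value `r = ⌊n/4⌋` is positive and at least `n / 8`.
  refine ⟨(1 - 2 * ε) ^ 2 / 16 * (1 / 8 : ℝ) ^ (3 / 2 : ℝ), by positivity, 4, ?_⟩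
  intro n hn 𝒜 h𝒜
  refine le_trans ?_ (h𝒜.le_queries (r := n / 4) (by omega) (by omega) hε)
  rw [mul_assoc, ← Real.mul_rpow (by norm_num) (Nat.cast_nonneg n)]
  have h : (n : ℝ) ≤ 8 * (n / 4 : ℕ) := by
    have : n ≤ 8 * (n / 4) := by omega
    exact_mod_cast this
  gcongr
  linarith
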